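/- **Setting.** Let $G$ be a causal diagram, i.e. a finite directed acyclic graph, with nodes $\mathcal V\cup\{Z\}$, $Z\notin\mathcal V$, and let $X\ne Y$ be two nodes in $\mathcal V$. Every node has finitely many states; $Z$ has $pq$ states $z_1,\dots,z_{pq}$. Let $O$ be observational data compatible with $G$, i.e. a joint probability distribution $P$ of all nodes that factorizes as the product, over the nodes, of conditional probability tables (CPTs) of each node given its parents in $G$. Let $G'$ be the directed graph with nodes $\mathcal V\cup\{W,U\}$ in which $\mathrm{Pa}_{G'}(U)=\mathrm{Pa}_G(Z)$, $\mathrm{Pa}_{G'}(W)=\mathrm{Pa}_G(Z)\cup\{U\}$, and, for $H\in\mathcal V$, $\mathrm{Pa}_{G'}(H)=\mathrm{Pa}_G(H)$ if $Z\notin \mathrm{Pa}_G(H)$ and $\mathrm{Pa}_{G'}(H)=(\mathrm{Pa}_G(H)\setminus\{Z\})\cup\{W,U\}$ if $Z\in\mathrm{Pa}_G(H)$. Let $W$ have $p$ states and $U$ have $q$ states, let all other nodes keep their states, and let $O'$ be the joint distribution $P'$ obtained from $P$ by identifying the pair of states $(w_j,u_k)$ with $z_{(j-1)q+k}$. For a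 set $Q$ of nodes of $G$ let $Q'=Q$ if $Z\notin Q$ and $Q'=(Q\setminus\{Z\})\cup\{W,U\}$ if $Z\in Q$. **Conventions.** Paths have distinct nodes and may run along or against arrows; blocking is the one of $d$-separation; a back-door path from $A$ is a path with an arrow into $A$; a node counts among its descendants. $Q$ satisfies the *back-door criterion* relative to $(X,Y)$ if no node of $Q$ is a descendant of $X$ and $Q$ blocks every back-door path from $X$ to $Y$. $Q$ satisfies the *front-door criterion* relative to $(X,Y)$ if (i) every directed path from $X$ to $Y$ meets $Q$, (ii) every back-door path from $X$ to a node of $Q$ is blocked by the empty set, and (iii) every back-door path from $Q$ to $Y$ (it starts at a node of $Q$ and has no other node in $Q$) is blocked by $\{X\}$. In a causal model with given CPTs, $P(y\mid do(x))$ is obtained by deleting the factor of $X$ from the product of the CPTs, setting $X=x$, and summing over all states with $Y=y$. The *causal effects of $X$ on $Y$ with $(G,O)$* are the functions $(x,y)\mapsto P(y\mid do(x))$ of all causal models on $G$ whose observational distribution is $O$ (a single function when the effect is determined by $G$ and $O$). **Theorem.** 1. $G'$ is acyclic, $O'$ is compatible with $G'$, and $P'(w_j,u_k,t)=P(z_{(j-1)q+k},t)$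 for all $j,k$ and every joint state $t$ of any set of nodes in $\mathcal V$. 2. If $Q$ satisfies the back-door criterion relative to $(X,Y)$ in $G$, then $Q'$ satisfies it in $G'$, and the adjustment formula $\sum_a P(y\mid x,a)P(a)$ (over the joint states $a$ of the set) has the same value for $(O,Q)$ and $(O',Q')$. 3. If $Q$ satisfies the front-door criterion relative to $(X,Y)$ in $G$, then $Q'$ satisfies it in $G'$, and the adjustment formula $\sum_a P(a\mid x)\sum_{x'}P(y\mid x',a)P(x')$ has the same value for $(O,Q)$ and $(O',Q')$. 4. $(G,O)$ and $(G',O')$ are equivalent: the causal effects of $X$ on $Y$ with $(G,O)$ and with $(G',O')$ are the same. In particular, if $P(y\mid do(x))$ is determined by $(G,O)$, then it is determined by $(G',O')$ and has the same value. (In the adjustment formulas, a quotient with denominator $0$ is read as $0$.) -/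

import Mathlib

open scoped BigOperators

/-! ### Paths, d-separation, back-door and front-door criteria in a directed graph -/

section Graphs

variable {N : Type*}

/-- The directed graph has no directed cycle (in particular no loop). -/
def Digraph.Acyclic (G : Digraph N) : Prop :=
  ∀ n, ¬ Relation.TransGen G.Adj n n

/-- `d` is a descendant of `n`; as usual, a node counts among its own descendants. -/
def Digraph.Descendant (G : Digraph N) (n d : N) : Prop :=
  Relation.ReflTransGen G.Adj n d

/-- `p` is the list of nodes of a path between `a` and `b`: the nodes are distinct and
consecutive nodes are joined by an arrow, whatever its direction. -/
def Digraph.IsPath (G : Digraph N) (a b : N) (p : List N) : Prop :=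
  p.Nodup ∧ p.IsChain (fun m n => G.Adj m n ∨ G.Adj n m) ∧
    p.head? = some a ∧ p.getLast? = some b

/-- `p` is a directed path from `a` to `b`: all arrows point towards `b`. -/
def Digraph.IsDirectedPath (G : Digraph N) (a b : N) (p : List N) : Prop :=
  p.Nodup ∧ p.IsChain G.Adj ∧ p.head? = some a ∧ p.getLast? = some b

/-- A back-door path from `a` to `b`: a path between `a` and `b` with an arrow into `a`
(as `a` is an end of the path, this arrow is the first one on it). -/
def Digraph.IsBackDoorPath (G : Digraph N) (a b : N) (p : List N) : Prop :=
  G.IsPath a b p ∧ ∃ m, [a, m] <+: p ∧ G.Adj m a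

/-- The path `p` is blocked by `S`: it contains a chain or a fork whose middle node is in `S`,
or a collider such that neither the collision node nor any descendant of it is in `S`. -/
def Digraph.Blocked (G : Digraph N) (S : Set N) (p : List N) : Prop :=
  ∃ a b c, [a, b, c] <:+: p ∧
    ((((G.Adj a b ∧ G.Adj b c) ∨ (G.Adj c b ∧ G.Adj b a) ∨ (G.Adj b a ∧ G.Adj b c)) ∧ b ∈ S) ∨
      ((G.Adj a b ∧ G.Adj c b) ∧ ∀ d, G.Descendant b d → d ∉ S))

/-- The back-door criterion for `Q` relative to the ordered pair `(X, Y)`. -/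
def Digraph.BackDoor (G : Digraph N) (X Y : N) (Q : Finset N) : Prop :=
  (∀ n ∈ Q, ¬ G.Descendant X n) ∧
    ∀ p, G.IsBackDoorPath X Y p → G.Blocked (Q : Set N) p

/-- The front-door criterion for `Q` relative to the ordered pair `(X, Y)`.
"No back-door path from `X` to `Q`" means, as always in this criterion, no unblocked one
(nothing is conditioned on). A path from the set `Q` to `Y` is a path that starts at a node of
`Q` and has no other node in `Q`. -/
def Digraph.FrontDoor (G : Digraph N) (X Y : N) (Q : Finset N) : Prop :=
  (∀ p, G.IsDirectedPath X Y p → ∃ n ∈ p, n ∈ Q) ∧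
    (∀ n ∈ Q, ∀ p, G.IsBackDoorPath X n p → G.Blocked ∅ p) ∧
    ∀ n ∈ Q, ∀ p, G.IsBackDoorPath n Y p → (∀ m ∈ p, m ∈ Q → m = n) → G.Blocked {X} p

end Graphs

/-! ### Observational data, causal models and causal effects -/

section Models

variable {N : Type*}

/-- A joint state of all nodes, where node `n` has the `r n` states `0, …, r n - 1`. -/
abbrev JointState (r : N → ℕ) : Type _ := ∀ n, Fin (r n)

variable [Fintype N] [DecidableEq N]

/-- `P` is a probability distribution on the joint states. -/
def IsDistribution {r : N → ℕ} (P : JointState r → ℝ) : Prop :=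
  (∀ s, 0 ≤ P s) ∧ ∑ s, P s = 1

open Classical in
/-- The probability of an event. -/
noncomputable def prob {r : N → ℕ} (P : JointState r → ℝ) (E : JointState r → Prop) : ℝ :=
  ∑ s, if E s then P s else 0

/-- A causal (Bayesian network) model on `G`: for every node and every joint state of its
parents, a probability distribution on the states of the node. -/
structure CausalModel (G : Digraph N) (r : N → ℕ) where
  /-- `cpt n a i` is the conditional probability of state `i` of `n` when the parents of `n`
  are in the joint state `a`. -/
  cpt : ∀ n, (∀ m : {m // G.Adj m n}, Fin (r m)) → Fin (r n) → ℝ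
  cpt_nonneg : ∀ n a i, 0 ≤ cpt n a i
  cpt_sum : ∀ n a, ∑ i, cpt n a i = 1

/-- The observational distribution of a causal model: the product of all conditional
probabilities. -/
noncomputable def CausalModel.observational {G : Digraph N} {r : N → ℕ} (M : CausalModel G r)
    (s : JointState r) : ℝ :=
  ∏ n, M.cpt n (fun m => s m) (s n)

/-- The joint distribution under the intervention `do(X = x)`: the factor of `X` is removed and
`X` is held at `x` (truncated factorization). -/
noncomputable def CausalModel.interventional {G : Digraph N} {r : N → ℕ} (M : CausalModel G r)
    (X : N) (x : Fin (r X)) (s : JointState r) : ℝ :=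
  if s X = x then ∏ n ∈ Finset.univ.erase X, M.cpt n (fun m => s m) (s n) else 0

/-- The causal effect `P(y | do(x))` in a causal model. -/
noncomputable def CausalModel.effect {G : Digraph N} {r : N → ℕ} (M : CausalModel G r)
    (X Y : N) (x : Fin (r X)) (y : Fin (r Y)) : ℝ :=
  prob (M.interventional X x) (fun s => s Y = y)

/-- The distribution `P` is compatible with `G`: it factorizes into conditional probabilities of
the nodes given their parents. -/
def Compatible (G : Digraph N) {r : N → ℕ} (P : JointState r → ℝ) : Prop :=
  IsDistribution P ∧ ∃ M : CausalModel G r, M.observational = P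

/-- The causal effects of `X` on `Y` with the graph `G` and the data `P`, that is, the functions
`(x, y) ↦ P(y | do(x))` of all causal models on `G` with observational distribution `P`. If the
causal effect is determined by `G` and `P`, this set has exactly one element; else (which needs
conditioning events of probability zero) it has all the admissible ones. -/
def causalEffects (G : Digraph N) {r : N → ℕ} (P : JointState r → ℝ) (X Y : N) :
    Set (Fin (r X) → Fin (r Y) → ℝ) :=
  {e | ∃ M : CausalModel G r, M.observational = P ∧ e = M.effect X Y}

/-- The back-door adjustment formula `∑_a P(y | x, a) P(a)`, over the joint states `a` of `Q`. -/
noncomputable def backDoorFormula {r : N → ℕ} (P : JointState r → ℝ) (X Y : N) (Q : Finset N)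
    (x : Fin (r X)) (y : Fin (r Y)) : ℝ :=
  ∑ a : (∀ n : Q, Fin (r n)),
    prob P (fun s => s X = x ∧ s Y = y ∧ ∀ n : Q, s n = a n) /
      prob P (fun s => s X = x ∧ ∀ n : Q, s n = a n) *
        prob P (fun s => ∀ n : Q, s n = a n)

/-- The front-door adjustment formula `∑_a P(a | x) ∑_{x'} P(y | x', a) P(x')`, over the joint
states `a` of `Q` and the states `x'` of `X`. -/
noncomputable def frontDoorFormula {r : N → ℕ} (P : JointState r → ℝ) (X Y : N) (Q : Finset N)
    (x : Fin (r X)) (y : Fin (r Y)) : ℝ :=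
  ∑ a : (∀ n : Q, Fin (r n)),
    prob P (fun s => s X = x ∧ ∀ n : Q, s n = a n) / prob P (fun s => s X = x) *
      ∑ x' : Fin (r X),
        prob P (fun s => s X = x' ∧ s Y = y ∧ ∀ n : Q, s n = a n) /
          prob P (fun s => s X = x' ∧ ∀ n : Q, s n = a n) *
            prob P (fun s => s X = x')

end Models

/-! ### Replacing the node `Z` by two nodes `W` and `U` -/

section Split

/-- The nodes of the original graph: `Z` and the other ones. -/
inductive NodeZ (V : Type*) where
  | old (v : V)
  | z
  deriving DecidableEq, Fintype

/-- The nodes of the new graph: `W`, `U`, and the nodes other than `Z` of the original graph. -/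
inductive NodeWU (V : Type*) where
  | old (v : V)
  | w
  | u
  deriving DecidableEq, Fintype

variable {V : Type*}

/-- Numbers of states in the original graph: `r v` for `v ≠ Z`, and `p * q` for `Z`. -/
def statesZ (r : V → ℕ) (p q : ℕ) : NodeZ V → ℕ
  | .old v => r v
  | .z => p * q

/-- Numbers of states in the new graph: `r v` for an old node `v`, `p` for `W`, `q` for `U`. -/
def statesWU (r : V → ℕ) (p q : ℕ) : NodeWU V → ℕ
  | .old v => r v
  | .w => p
  | .u => q

/-- The new graph: `U` has the parents of `Z`; `W` has the parents of `Z` and `U`; every other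
node keeps its parents, except that `Z` is replaced by `W` and `U`. -/
def splitGraph (G : Digraph (NodeZ V)) : Digraph (NodeWU V) where
  Adj
    | .old a, .old b => G.Adj (.old a) (.old b)
    | .old a, .w => G.Adj (.old a) .z
    | .old a, .u => G.Adj (.old a) .z
    | .w, .old b => G.Adj .z (.old b)
    | .u, .old b => G.Adj .z (.old b)
    | .u, .w => True
    | .w, .w => False
    | .w, .u => False
    | .u, .u => False

/-- The state of the original nodes that a state of the new nodes stands for. With states counted
from `0`, `finProdFinEquiv (j, k) = j * q + k`. -/
def mergeState {r : V → ℕ} {p q : ℕ} (s : JointState (statesWU r p q)) :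
    JointState (statesZ r p q)
  | .old v => s (.old v)
  | .z => finProdFinEquiv ((s .w : Fin p), (s .u : Fin q))

/-- The new observational data: the pair of states of `W` and `U` is the state of `Z`. -/
def splitData {r : V → ℕ} {p q : ℕ} (P : JointState (statesZ r p q) → ℝ) :
    JointState (statesWU r p q) → ℝ :=
  fun s => P (mergeState s)

variable [DecidableEq V]

/-- `Q' = Q` if `Z ∉ Q`, and `Q' = (Q \ {Z}) ∪ {W, U}` if `Z ∈ Q`. -/
def splitSet [Fintype V] (Q : Finset (NodeZ V)) : Finset (NodeWU V) :=
  (Finset.univ.filter fun v : V => NodeZ.old v ∈ Q).image NodeWU.old ∪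
    if NodeZ.z ∈ Q then {NodeWU.w, NodeWU.u} else ∅

end Split

/-! ### Colliders and consecutive triples on paths -/

section GraphLemmas

variable {N : Type*}

/-! Merging `w` and `u` into `z` preserves every arrow except `u → w`, which collapses to a point,
and it is a bijection on joint states. Acyclicity therefore transfers, and the probability
identities and adjustment formulas are mere reindexings.

For the criteria, an unblocked back-door path of the new graph is turned into one of the original
graph (`exists_backDoorPath_of_splitGraph`). If it meets at most one of `w` and `u`, its image
works. Otherwise the stretch between them is cut out and both ends become one `z`;
`not_blockedAt_shortcut` shows that the triple created around `z` does not block.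

For causal effects, the chain rule splits the table of `z` into that of `u` given the parents of `z`
and that of `w` given these parents and `u`; multiplying reverses this. Models related by
`CausalModel.Matches` have the same truncated products, because `X` is not `z`. Every model on
either graph has such a partner (`CausalModel.merge`, `CausalModel.split`), so the sets of effects
coincide. -/

theorem Digraph.Acyclic.not_adj_self {G : Digraph N} (hG : G.Acyclic) (a : N) : ¬ G.Adj a a :=
  fun h => hG a (.single h)

theorem Digraph.Acyclic.asymm {G : Digraph N} (hG : G.Acyclic) {a b : N} (h : G.Adj a b) :
    ¬ G.Adj b a :=
  fun h' => hG a (.tail (.single h) h')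

/-- In an acyclic graph, a list whose consecutive nodes are joined by arrows has no repetitions. -/
theorem Digraph.Acyclic.nodup_of_isChain {G : Digraph N} (hG : G.Acyclic) {l : List N}
    (hl : l.IsChain G.Adj) : l.Nodup := by
  have h : l.IsChain (Relation.TransGen G.Adj) := hl.imp fun _ _ => .single
  have h2 := List.isChain_iff_pairwise.1 h
  refine h2.imp ?_
  rintro a b hab rfl
  exact hG _ hab

/-- The triple `a, b, c` of consecutive nodes blocks a path, given `S`. -/
def Digraph.BlockedAt (G : Digraph N) (S : Set N) (a b c : N) : Prop :=
  (((G.Adj a b ∧ G.Adj b c) ∨ (G.Adj c b ∧ G.Adj b a) ∨ (G.Adj b a ∧ G.Adj b c)) ∧ b ∈ S) ∨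
    ((G.Adj a b ∧ G.Adj c b) ∧ ∀ d, G.Descendant b d → d ∉ S)

/-- A path that starts along an arrow and ends against an arrow has a collider that is reached
from its second node by following arrows. -/
theorem Digraph.Acyclic.exists_collider {G : Digraph N} (hG : G.Acyclic) {c d : N}
    (hdc : G.Adj d c) :
    ∀ (t : List N) (a b : N), (a :: b :: t).IsChain (fun m n => G.Adj m n ∨ G.Adj n m) →
      G.Adj a b → [c, d] <:+ a :: b :: t →
      ∃ x y z, [x, y, z] <:+: a :: b :: t ∧ G.Adj x y ∧ G.Adj z y ∧ G.Descendant b y := by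
  intro t
  induction t with
  | nil =>
    intro a b _ hab hs
    have := hs.eq_of_length (by simp)
    simp only [List.cons.injEq, and_true] at this
    obtain ⟨rfl, rfl⟩ := this
    exact absurd hdc (hG.asymm hab)
  | cons e t ih =>
    intro a b hc hab hs
    rw [List.isChain_cons_cons] at hc
    -- Either the next arrow continues forward and the search moves on, or it turns back and `b` is
    -- the collider.
    obtain h | h := (List.isChain_cons_cons.1 hc.2).1
    · have hs' : [c, d] <:+ b :: e :: t := by
        rcases List.suffix_cons_iff.1 hs with h' | h'
        · simp at h'
        · exact h'
      obtain ⟨x, y, z, hi, h1, h2, h3⟩ := ih b e hc.2 h hs'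
      exact ⟨x, y, z, hi.trans (List.suffix_cons _ _).isInfix, h1, h2, .head h h3⟩
    · exact ⟨a, b, e, ⟨[], t, by simp⟩, hab, h, .refl⟩

/-- The consecutive triples of a concatenation with common node `z`. -/
theorem List.triple_infix_append_cons {a b c z : N} {l₁ l₂ : List N}
    (h : [a, b, c] <:+: l₁ ++ z :: l₂) :
    [a, b, c] <:+: l₁ ++ [z] ∨ [a, b, c] <:+: z :: l₂ ∨
      (b = z ∧ [a] <:+ l₁ ∧ [c] <+: l₂) := by
  induction l₁ with
  | nil => exact .inr (.inl h)
  | cons x l₁ ih =>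
    rw [List.cons_append, List.infix_cons_iff] at h
    rcases h with h | h
    · rcases l₁ with _ | ⟨y, _ | ⟨y', l₁⟩⟩
      · simp only [List.nil_append, List.cons_prefix_cons] at h
        obtain ⟨rfl, rfl, h⟩ := h
        exact .inr (.inr ⟨rfl, List.suffix_rfl, h⟩)
      · simp only [List.cons_append, List.nil_append, List.cons_prefix_cons] at h
        obtain ⟨rfl, rfl, rfl, -⟩ := h
        exact .inl (List.infix_rfl)
      · simp only [List.cons_append, List.cons_prefix_cons] at h
        obtain ⟨rfl, rfl, rfl, -⟩ := h
        exact .inl ⟨[], l₁ ++ [z], by simp⟩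
    · rcases ih h with h | h | ⟨h1, h2, h3⟩
      · exact .inl (h.trans (List.suffix_cons _ _).isInfix)
      · exact .inr (.inl h)
      · exact .inr (.inr ⟨h1, h2.trans (List.suffix_cons _ _), h3⟩)

end GraphLemmas

/-! ### Merging nodes: arrows, descendants and paths -/

section SplitGraphLemmas

variable {V : Type*} {G : Digraph (NodeZ V)}

/-- The node of the original graph that a node of the new graph stands for. -/
def NodeWU.merge : NodeWU V → NodeZ V
  | .old v => .old v
  | .w => .z
  | .u => .z

theorem NodeWU.eq_of_merge_eq {a b : NodeWU V} (h : a.merge = b.merge)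
    (h1 : ¬ (a = .u ∧ b = .w)) (h2 : ¬ (a = .w ∧ b = .u)) : a = b := by
  cases a <;> cases b <;> simp_all [NodeWU.merge]

/-- The arrow `u → w` is the only one without a counterpart. Acyclicity rules out a loop at `z`,
which would otherwise be the image of non-adjacent pairs. -/
theorem splitGraph_adj {a b : NodeWU V} (hG : G.Acyclic) (h : ¬ (a = .u ∧ b = .w)) :
    (splitGraph G).Adj a b ↔ G.Adj a.merge b.merge := by
  have := hG.not_adj_self .z
  cases a <;> cases b <;> simp_all [NodeWU.merge, splitGraph]

theorem adj_merge_or_of_splitGraph_adj {a b : NodeWU V} (h : (splitGraph G).Adj a b) :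
    G.Adj a.merge b.merge ∨ (a = .u ∧ b = .w) := by
  cases a <;> cases b <;> simp_all [NodeWU.merge, splitGraph]

theorem splitGraph_acyclic (hG : G.Acyclic) : (splitGraph G).Acyclic := by
  -- A walk either has a nonempty image or is the single arrow `u → w`, which is not closed.
  have key : ∀ a b, Relation.TransGen (splitGraph G).Adj a b →
      Relation.TransGen G.Adj a.merge b.merge ∨ (a = .u ∧ b = .w) := by
    intro a b h
    induction h with
    | single h => exact (adj_merge_or_of_splitGraph_adj h).imp .single id
    | tail _ h ih =>
      rcases ih with ih | ⟨rfl, rfl⟩ <;>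
        rcases adj_merge_or_of_splitGraph_adj h with h | ⟨h1, h2⟩
      · exact .inl (ih.tail h)
      · subst h1 h2; exact .inl ih
      · exact .inl (.single h)
      · cases h1
  intro n h
  rcases key n n h with h | ⟨rfl, h⟩
  · exact hG _ h
  · cases h

theorem Digraph.Descendant.merge {a b : NodeWU V} (h : (splitGraph G).Descendant a b) :
    G.Descendant a.merge b.merge := by
  induction h with
  | refl => exact .refl
  | tail _ h ih =>
    rcases adj_merge_or_of_splitGraph_adj h with h | ⟨rfl, rfl⟩
    · exact .tail ih h
    · exact ih

theorem Digraph.Descendant.exists_split (hG : G.Acyclic) {a : NodeWU V} {d : NodeZ V}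
    (h : G.Descendant a.merge d) : ∃ b : NodeWU V, b.merge = d ∧ (splitGraph G).Descendant a b := by
  induction h with
  | refl => exact ⟨a, rfl, .refl⟩
  | @tail d e _ h ih =>
    obtain ⟨b, rfl, hb⟩ := ih
    cases e with
    | old v =>
      refine ⟨.old v, rfl, .tail hb ?_⟩
      rw [splitGraph_adj hG (by simp)]
      exact h
    | z =>
      -- Entering through `u` is a free choice: `w` has the same old parents.
      refine ⟨.u, rfl, .tail hb ?_⟩
      rw [splitGraph_adj hG (by simp)]
      exact h

/-- No node of `S` is a descendant of `a.merge`, if none of the nodes it stands for is one of `a`. -/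
theorem forall_descendant_notMem_iff (hG : G.Acyclic) {S : Set (NodeZ V)} {a : NodeWU V} :
    (∀ d, (splitGraph G).Descendant a d → d ∉ NodeWU.merge ⁻¹' S) ↔
      ∀ d, G.Descendant a.merge d → d ∉ S := by
  constructor
  · intro h d hd
    obtain ⟨b, rfl, hb⟩ := Digraph.Descendant.exists_split hG hd
    exact h b hb
  · exact fun h d hd => h _ hd.merge

/-- A list of nodes that does not contain both `w` and `u`. -/
def NotBoth (l : List (NodeWU V)) : Prop := ¬ (.w ∈ l ∧ .u ∈ l)

theorem NotBoth.mono {l l' : List (NodeWU V)} (h : NotBoth l) (hl : l' ⊆ l) : NotBoth l' :=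
  fun h' => h ⟨hl h'.1, hl h'.2⟩

theorem NotBoth.adj_iff (hG : G.Acyclic) {l : List (NodeWU V)} (h : NotBoth l) {a b : NodeWU V}
    (ha : a ∈ l) (hb : b ∈ l) : (splitGraph G).Adj a b ↔ G.Adj a.merge b.merge :=
  splitGraph_adj hG (by rintro ⟨rfl, rfl⟩; exact h ⟨hb, ha⟩)

theorem NotBoth.nodup_map {l : List (NodeWU V)} (h : NotBoth l) (hl : l.Nodup) :
    (l.map NodeWU.merge).Nodup := by
  refine hl.map_on fun a ha b hb hab => NodeWU.eq_of_merge_eq hab ?_ ?_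
  · rintro ⟨rfl, rfl⟩; exact h ⟨hb, ha⟩
  · rintro ⟨rfl, rfl⟩; exact h ⟨ha, hb⟩

theorem NotBoth.isChain_map (hG : G.Acyclic) {l : List (NodeWU V)} (h : NotBoth l)
    (hl : l.IsChain fun m n => (splitGraph G).Adj m n ∨ (splitGraph G).Adj n m) :
    (l.map NodeWU.merge).IsChain fun m n => G.Adj m n ∨ G.Adj n m := by
  rw [List.isChain_map]
  rw [List.isChain_iff_forall_rel_of_append_cons_cons] at hl ⊢
  intro a b l₁ l₂ hl'
  have ha : a ∈ l := by simp [hl']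
  have hb : b ∈ l := by simp [hl']
  rw [← h.adj_iff hG ha hb, ← h.adj_iff hG hb ha]
  exact hl hl'

theorem NotBoth.blockedAt_iff (hG : G.Acyclic) {S : Set (NodeZ V)} {l : List (NodeWU V)}
    (h : NotBoth l) {a b c : NodeWU V} (ha : a ∈ l) (hb : b ∈ l) (hc : c ∈ l) :
    (splitGraph G).BlockedAt (NodeWU.merge ⁻¹' S) a b c ↔
      G.BlockedAt S a.merge b.merge c.merge := by
  unfold Digraph.BlockedAt
  rw [forall_descendant_notMem_iff hG, h.adj_iff hG ha hb, h.adj_iff hG hb ha,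
    h.adj_iff hG hb hc, h.adj_iff hG hc hb, Set.mem_preimage]

theorem NotBoth.not_blockedAt_map (hG : G.Acyclic) {S : Set (NodeZ V)} {l : List (NodeWU V)}
    (h : NotBoth l)
    (hl : ∀ a b c, [a, b, c] <:+: l → ¬ (splitGraph G).BlockedAt (NodeWU.merge ⁻¹' S) a b c)
    {a b c : NodeZ V} (habc : [a, b, c] <:+: l.map NodeWU.merge) : ¬ G.BlockedAt S a b c := by
  obtain ⟨l', hl', he⟩ := List.infix_map_iff.1 habc
  obtain ⟨a, b, c, rfl⟩ : ∃ a b c, l' = [a, b, c] :=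
    List.length_eq_three.1 (by simpa using (congrArg List.length he).symm)
  simp only [List.map_cons, List.map_nil, List.cons.injEq, and_true] at he
  obtain ⟨rfl, rfl, rfl⟩ := he
  have hs := hl'.subset
  rw [← h.blockedAt_iff hG (hs (by simp)) (hs (by simp)) (hs (by simp))]
  exact hl _ _ _ hl'

theorem exists_eq_append_of_not_notBoth {l : List (NodeWU V)} (h : ¬ NotBoth l) :
    ∃ (c₁ c₂ : NodeWU V) (l₁ m l₂ : List (NodeWU V)), l = l₁ ++ c₁ :: (m ++ c₂ :: l₂) ∧
      (c₁ = .w ∧ c₂ = .u ∨ c₁ = .u ∧ c₂ = .w) := by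
  obtain ⟨hw, hu⟩ := not_not.1 h
  obtain ⟨l₁, l₂, rfl⟩ := List.append_of_mem hw
  rw [List.mem_append, List.mem_cons] at hu
  rcases hu with hu | hu | hu
  · obtain ⟨k₁, k₂, rfl⟩ := List.append_of_mem hu
    exact ⟨.u, .w, k₁, k₂, l₂, by simp, .inr ⟨rfl, rfl⟩⟩
  · cases hu
  · obtain ⟨k₁, k₂, rfl⟩ := List.append_of_mem hu
    exact ⟨.w, .u, l₁, k₁, k₂, by simp, .inl ⟨rfl, rfl⟩⟩

/-- Of a path through both `w` and `u`, the part between them can be cut out without blocking. -/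
theorem not_blockedAt_shortcut (hG : G.Acyclic) {S : Set (NodeZ V)} {c₁ c₂ a d : NodeWU V}
    {m p : List (NodeWU V)} (hc : c₁ = .w ∧ c₂ = .u ∨ c₁ = .u ∧ c₂ = .w)
    (ha : a ≠ .w ∧ a ≠ .u) (hd : d ≠ .w ∧ d ≠ .u)
    (hp : p = a :: c₁ :: (m ++ [c₂, d]))
    (hch : p.IsChain fun m n => (splitGraph G).Adj m n ∨ (splitGraph G).Adj n m)
    (ho : ∀ a b c, [a, b, c] <:+: p → ¬ (splitGraph G).BlockedAt (NodeWU.merge ⁻¹' S) a b c) :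
    ¬ G.BlockedAt S a.merge .z d.merge := by
  have hm₁ : c₁.merge = .z := by rcases hc with ⟨rfl, -⟩ | ⟨rfl, -⟩ <;> rfl
  have hm₂ : c₂.merge = .z := by rcases hc with ⟨-, rfl⟩ | ⟨-, rfl⟩ <;> rfl
  have hac : (splitGraph G).Adj a c₁ ↔ G.Adj a.merge .z := by
    rw [splitGraph_adj hG (by tauto), hm₁]
  have hca : (splitGraph G).Adj c₁ a ↔ G.Adj .z a.merge := by
    rw [splitGraph_adj hG (by tauto), hm₁]
  have hcd : (splitGraph G).Adj c₂ d ↔ G.Adj .z d.merge := by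
    rw [splitGraph_adj hG (by tauto), hm₂]
  have hdc : (splitGraph G).Adj d c₂ ↔ G.Adj d.merge .z := by
    rw [splitGraph_adj hG (by tauto), hm₂]
  rintro (⟨h, hz⟩ | ⟨⟨haz, hdz⟩, hS⟩)
  -- A non-collider at `z` has an arrow out to `a` or `d`. The corresponding `c₁` or `c₂` is then a
  -- non-collider of `p`, whatever its other arrow, and it lies over `z ∈ S`, so `p` would already
  -- be blocked there.
  · have h' : (splitGraph G).Adj c₁ a ∨ (splitGraph G).Adj c₂ d := by
      rw [hca, hcd]; tauto
    rcases h' with h' | h'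
    · obtain ⟨x, t, ht⟩ : ∃ x t, m ++ [c₂, d] = x :: t := by
        cases m <;> simp
      rw [ht] at hp
      subst hp
      refine ho a c₁ x ⟨[], t, by simp⟩ (.inl ⟨?_, by simpa [hm₁] using hz⟩)
      obtain h | h := (List.isChain_cons_cons.1 (List.isChain_cons_cons.1 hch).2).1
      · exact .inr (.inr ⟨h', h⟩)
      · exact .inr (.inl ⟨h, h'⟩)
    · obtain ⟨x, t, ht⟩ : ∃ x t, a :: c₁ :: m = t ++ [x] :=
        ⟨(a :: c₁ :: m).getLast (by simp), (a :: c₁ :: m).dropLast, by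
          rw [List.dropLast_append_getLast]⟩
      have hp' : p = t ++ [x, c₂, d] := by
        rw [hp, ← List.cons_append, ← List.cons_append, ht]; simp
      subst hp'
      refine ho x c₂ d ⟨t, [], by simp⟩ (.inl ⟨?_, by simpa [hm₂] using hz⟩)
      obtain h | h := (List.isChain_cons_cons.1 (List.isChain_append.1 hch).2.1).1
      · exact .inl ⟨h, h'⟩
      · exact .inr (.inr ⟨h, h'⟩)
  · subst hp
    -- The detour is entered and left by arrows pointing into it, so it contains a collider
    -- descending from `c₁`. Its descendants lie over descendants of `z`, hence outside `S`, and it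
    -- would block `p`.
    obtain ⟨x, y, z, hi, h1, h2, h3⟩ := (splitGraph_acyclic hG).exists_collider (hdc.2 hdz)
      (m ++ [c₂, d]) a c₁ hch (hac.2 haz) ⟨a :: c₁ :: m, by simp⟩
    refine ho x y z hi (.inr ⟨⟨h1, h2⟩, ?_⟩)
    rw [forall_descendant_notMem_iff hG]
    intro e he
    refine hS e (Relation.ReflTransGen.trans ?_ he)
    rw [← hm₁]
    exact h3.merge

/-- An unblocked back-door path in the new graph gives one in the original graph. -/
theorem exists_backDoorPath_of_splitGraph (hG : G.Acyclic) {S : Set (NodeZ V)} {a b : NodeWU V}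
    {p : List (NodeWU V)} (hp : (splitGraph G).IsBackDoorPath a b p)
    (ho : ¬ (splitGraph G).Blocked (NodeWU.merge ⁻¹' S) p)
    (ha : (a ≠ .w ∧ a ≠ .u) ∨ NotBoth p) :
    ∃ q, G.IsBackDoorPath a.merge b.merge q ∧ ¬ G.Blocked S q ∧ ∀ n ∈ q, ∃ m ∈ p, m.merge = n := by
  obtain ⟨⟨hnd, hch, hhd, hla⟩, m₀, hm₀, hadj⟩ := hp
  replace ho : ∀ a b c, [a, b, c] <:+: p →
      ¬ (splitGraph G).BlockedAt (NodeWU.merge ⁻¹' S) a b c :=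
    fun a b c h h' => ho ⟨a, b, c, h, h'⟩
  by_cases hb : NotBoth p
  · refine ⟨p.map NodeWU.merge, ⟨⟨hb.nodup_map hnd, hb.isChain_map hG hch, ?_, ?_⟩, m₀.merge, ?_, ?_⟩,
      ?_, ?_⟩
    · simp [hhd]
    · simp [hla]
    · simpa using hm₀.map NodeWU.merge
    · exact (hb.adj_iff hG (hm₀.subset (by simp)) (hm₀.subset (by simp))).1 hadj
    · rintro ⟨a, b, c, h, h'⟩
      exact hb.not_blockedAt_map hG ho h h'
    · simp
  replace ha := ha.resolve_right hb
  obtain ⟨c₁, c₂, l₁, m, l₂, rfl, hc⟩ := exists_eq_append_of_not_notBoth hb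
  have hm₁ : c₁.merge = .z := by rcases hc with ⟨rfl, -⟩ | ⟨rfl, -⟩ <;> rfl
  have hm₂ : c₂.merge = .z := by rcases hc with ⟨-, rfl⟩ | ⟨-, rfl⟩ <;> rfl
  obtain ⟨l, rfl⟩ : ∃ l, l₁ = a :: l := by
    cases l₁ with
    | nil =>
      simp only [List.nil_append, List.head?_cons, Option.some.injEq] at hhd
      subst hhd
      tauto
    | cons x l =>
      simp only [List.cons_append, List.head?_cons, Option.some.injEq] at hhd
      exact ⟨l, by rw [hhd]⟩
  -- As `p` has no repetitions, `c₁` and `c₂` use up both `w` and `u`.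
  have hold : ∀ x, x ∈ a :: l ∨ x ∈ l₂ → x ≠ .w ∧ x ≠ .u := by
    intro x hx
    simp only [List.nodup_append, List.nodup_cons, List.mem_append, List.mem_cons] at hnd hx
    grind
  have hsub : (a :: l ++ c₁ :: l₂).Sublist (a :: l ++ c₁ :: (m ++ c₂ :: l₂)) :=
    List.Sublist.append_left (.cons_cons _ ((List.sublist_cons_self _ _).trans
      (List.sublist_append_right _ _))) _
  have hnb : NotBoth (a :: l ++ c₁ :: l₂) := by
    rintro ⟨hw, hu⟩
    have hw' := hold .w
    have hu' := hold .u
    simp only [List.mem_append, List.mem_cons] at hw hu hw' hu'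
    grind
  have hi₁ : (a :: l ++ [c₁]) <+: (a :: l ++ c₁ :: (m ++ c₂ :: l₂)) := ⟨m ++ c₂ :: l₂, by simp⟩
  have hi₂ : (c₂ :: l₂) <:+ (a :: l ++ c₁ :: (m ++ c₂ :: l₂)) := ⟨a :: l ++ c₁ :: m, by simp⟩
  have hnb₁ : NotBoth (a :: l ++ [c₁]) := hnb.mono (by simp [List.subset_def]; tauto)
  have hnb₂ : NotBoth (c₂ :: l₂) := by
    rintro ⟨hw, hu⟩
    have hw' := hold .w
    have hu' := hold .u
    simp only [List.mem_cons] at hw hu hw' hu'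
    grind
  have hq : (a :: l ++ c₁ :: l₂).map NodeWU.merge
      = (a :: l).map NodeWU.merge ++ .z :: l₂.map NodeWU.merge := by simp [hm₁]
  have hq₁ : (a :: l ++ [c₁]).map NodeWU.merge = (a :: l).map NodeWU.merge ++ [.z] := by simp [hm₁]
  have hq₂ : (c₂ :: l₂).map NodeWU.merge = .z :: l₂.map NodeWU.merge := by simp [hm₂]
  have hch₁ := hnb₁.isChain_map hG (hch.infix hi₁.isInfix)
  have hch₂ := hnb₂.isChain_map hG (hch.infix hi₂.isInfix)
  refine ⟨(a :: l ++ c₁ :: l₂).map NodeWU.merge,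
    ⟨⟨hnb.nodup_map (hnd.sublist hsub), ?_, by simp, ?_⟩, m₀.merge, ?_, ?_⟩, ?_, ?_⟩
  · rw [hq, List.isChain_split]
    exact ⟨hq₁ ▸ hch₁, hq₂ ▸ hch₂⟩
  · have hla' : (c₂ :: l₂).getLast? = some b := by
      rw [← hla, ← List.cons_append, ← List.append_assoc, List.getLast?_append_cons]
    have : ((c₂ :: l₂).map NodeWU.merge).getLast? = some b.merge := by
      rw [List.getLast?_map, hla']; rfl
    rw [hq, List.getLast?_append_cons, ← hq₂, this]
  · have h1 : [a, m₀] <+: a :: l ++ [c₁] := List.prefix_of_prefix_length_le hm₀ hi₁ (by simp)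
    have h2 := h1.map NodeWU.merge
    rw [hq₁] at h2
    rw [hq]
    exact h2.trans ⟨l₂.map NodeWU.merge, by simp⟩
  · refine (splitGraph_adj hG ?_).1 hadj
    tauto
  · rintro ⟨x, y, t, h, h'⟩
    rw [hq] at h
    -- Triples on either side of the cut are images of triples of `p`; only the one centred at `z`
    -- is new.
    rcases List.triple_infix_append_cons h with h | h | ⟨rfl, h1, h2⟩
    · rw [← hq₁] at h
      exact hnb₁.not_blockedAt_map hG (fun _ _ _ h => ho _ _ _ (h.trans hi₁.isInfix)) h h'
    · rw [← hq₂] at h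
      exact hnb₂.not_blockedAt_map hG (fun _ _ _ h => ho _ _ _ (h.trans hi₂.isInfix)) h h'
    · obtain ⟨k₁, hk₁, hx⟩ := List.suffix_map_iff.1 h1
      obtain ⟨k₂, hk₂, ht⟩ := List.prefix_map_iff.1 h2
      obtain ⟨x, rfl⟩ := List.length_eq_one_iff.1 (by simpa using (congrArg List.length hx).symm)
      obtain ⟨t, rfl⟩ := List.length_eq_one_iff.1 (by simpa using (congrArg List.length ht).symm)
      simp only [List.map_cons, List.map_nil, List.cons.injEq, and_true] at hx ht
      subst hx ht
      have hi : (x :: c₁ :: (m ++ [c₂, t])) <:+: (a :: l ++ c₁ :: (m ++ c₂ :: l₂)) := by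
        obtain ⟨s, hs⟩ := hk₁
        obtain ⟨s', hs'⟩ := hk₂
        exact ⟨s, s', by rw [← hs, ← hs']; simp⟩
      exact not_blockedAt_shortcut hG hc (hold x (.inl (hk₁.subset (by simp))))
        (hold t (.inr (hk₂.subset (by simp)))) rfl (hch.infix hi)
        (fun _ _ _ h => ho _ _ _ (h.trans hi)) h'
  · intro n hn
    obtain ⟨y, hy, rfl⟩ := List.mem_map.1 hn
    exact ⟨y, hsub.subset hy, rfl⟩

/-! ### Transfer of the back-door and front-door criteria -/

variable [Fintype V] [DecidableEq V]

theorem mem_splitSet {Q : Finset (NodeZ V)} {n : NodeWU V} : n ∈ splitSet Q ↔ n.merge ∈ Q := by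
  unfold splitSet
  cases n <;> split_ifs <;> simp_all [NodeWU.merge]

theorem coe_splitSet {Q : Finset (NodeZ V)} :
    (splitSet Q : Set (NodeWU V)) = NodeWU.merge ⁻¹' (Q : Set (NodeZ V)) := by
  ext n
  simp [mem_splitSet]

theorem Digraph.BackDoor.split (hG : G.Acyclic) {X Y : V} {Q : Finset (NodeZ V)}
    (h : G.BackDoor (.old X) (.old Y) Q) :
    (splitGraph G).BackDoor (.old X) (.old Y) (splitSet Q) := by
  refine ⟨fun n hn hd => h.1 _ (mem_splitSet.1 hn) hd.merge, fun p hp => ?_⟩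
  by_contra hb
  rw [coe_splitSet] at hb
  obtain ⟨q, hq, hq', -⟩ := exists_backDoorPath_of_splitGraph hG hp hb (.inl (by simp))
  exact hq' (h.2 q hq)

theorem Digraph.FrontDoor.split (hG : G.Acyclic) {X Y : V} {Q : Finset (NodeZ V)}
    (h : G.FrontDoor (.old X) (.old Y) Q) :
    (splitGraph G).FrontDoor (.old X) (.old Y) (splitSet Q) := by
  refine ⟨fun p hp => ?_, fun n hn p hp => ?_, fun n hn p hp hQ => ?_⟩
  · by_contra! hno
    obtain ⟨-, hch, hhd, hla⟩ := hp
    -- Steps `u → w` are dropped from the image walk; acyclicity later makes it a path.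
    have key : ∀ (t : List (NodeWU V)) (a : NodeWU V), (a :: t).IsChain (splitGraph G).Adj →
        ∀ b, (a :: t).getLast? = some b → ∃ q, (a.merge :: q).IsChain G.Adj ∧
          (a.merge :: q).getLast? = some b.merge ∧ ∀ n ∈ q, ∃ m ∈ t, m.merge = n := by
      intro t
      induction t with
      | nil =>
        intro a _ b hb
        simp only [List.getLast?_singleton, Option.some.injEq] at hb
        exact ⟨[], by simp, by simp [hb], by simp⟩
      | cons c t ih =>
        intro a hc b hb
        rw [List.isChain_cons_cons] at hc
        obtain ⟨q, h1, h2, h3⟩ := ih c hc.2 b (by simpa using hb)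
        rcases adj_merge_or_of_splitGraph_adj hc.1 with h | ⟨rfl, rfl⟩
        · refine ⟨c.merge :: q, List.isChain_cons_cons.2 ⟨h, h1⟩, by simpa using h2, ?_⟩
          grind
        · exact ⟨q, h1, h2, by grind⟩
    obtain ⟨t, rfl⟩ : ∃ t, p = .old X :: t := by
      cases p with
      | nil => simp at hhd
      | cons x l => exact ⟨l, by simpa using hhd⟩
    obtain ⟨q, h1, h2, h3⟩ := key t _ hch _ hla
    obtain ⟨n, hn, hnQ⟩ := h.1 _ ⟨hG.nodup_of_isChain h1, h1, rfl, h2⟩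
    have : ∃ m ∈ .old X :: t, m.merge = n := by
      rcases List.mem_cons.1 hn with rfl | hn
      · exact ⟨_, by simp, rfl⟩
      · obtain ⟨m, hm, hm'⟩ := h3 n hn
        exact ⟨m, by simp [hm], hm'⟩
    obtain ⟨m, hm, rfl⟩ := this
    exact hno m hm (mem_splitSet.2 hnQ)
  · by_contra hb
    rw [← Set.preimage_empty (f := NodeWU.merge)] at hb
    obtain ⟨q, hq, hq', -⟩ := exists_backDoorPath_of_splitGraph hG hp hb (.inl (by simp))
    exact hq' (h.2.1 _ (mem_splitSet.1 hn) q hq)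
  · by_contra hb
    have hX : ({.old X} : Set (NodeWU V)) = NodeWU.merge ⁻¹' {.old X} := by
      ext n; cases n <;> simp [NodeWU.merge]
    rw [hX] at hb
    obtain ⟨q, hq, hq', hs⟩ := exists_backDoorPath_of_splitGraph hG hp hb <| by
      -- A path starting at `w` or `u` and meeting both, such as one beginning `w ← u`, could lose
      -- its back-door arrow. It is excluded because both nodes then lie in `splitSet Q`, where only
      -- the start is allowed.
      by_contra! hcon
      obtain ⟨h1, h2⟩ := hcon
      obtain ⟨hw, hu⟩ := not_not.1 h2
      have hz : NodeZ.z ∈ Q := by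
        have := mem_splitSet.1 hn
        by_cases hnw : n = .w
        · subst hnw; exact this
        · rw [h1 hnw] at this; exact this
      have e1 := hQ .w hw (mem_splitSet.2 hz)
      have e2 := hQ .u hu (mem_splitSet.2 hz)
      rw [← e1] at e2
      cases e2
    refine hq' (h.2.2 _ (mem_splitSet.1 hn) q hq fun m hm hmQ => ?_)
    obtain ⟨k, hk, rfl⟩ := hs m hm
    rw [hQ k hk (mem_splitSet.2 hmQ)]

end SplitGraphLemmas

/-! ### Transport of joint states and probabilities -/

section ModelLemmas

variable {V : Type*} {r : V → ℕ} {p q : ℕ}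

/-- Joint states of the new nodes are joint states of the original nodes. -/
def mergeEquiv : JointState (statesWU r p q) ≃ JointState (statesZ r p q) where
  toFun := mergeState
  invFun s
    | .old v => s (.old v)
    | .w => (finProdFinEquiv.symm (s .z : Fin (p * q))).1
    | .u => (finProdFinEquiv.symm (s .z : Fin (p * q))).2
  left_inv s := by
    funext n
    cases n with
    | old v => rfl
    | w => exact congrArg Prod.fst (finProdFinEquiv.symm_apply_apply ((s .w : Fin p), (s .u : Fin q)))
    | u => exact congrArg Prod.snd (finProdFinEquiv.symm_apply_apply ((s .w : Fin p), (s .u : Fin q)))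
  right_inv s := by
    funext n
    cases n with
    | old v => rfl
    | z => exact finProdFinEquiv.apply_symm_apply (s .z : Fin (p * q))

theorem mergeState_z_eq_iff (s : JointState (statesWU r p q)) (j : Fin p) (k : Fin q) :
    mergeState s .z = finProdFinEquiv (j, k) ↔ s .w = j ∧ s .u = k := by
  exact (finProdFinEquiv.injective.eq_iff (a := ((s .w : Fin p), (s .u : Fin q)))).trans
    Prod.mk_inj

/-- `NodeZ V` is `V` with one more element. -/
def NodeZ.equivOption : NodeZ V ≃ Option V where
  toFun | .old v => some v | .z => none
  invFun | some v => .old v | none => .z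
  left_inv n := by cases n <;> rfl
  right_inv n := by cases n <;> rfl

/-- `NodeWU V` is `V` with two more elements. -/
def NodeWU.equivOption : NodeWU V ≃ Option (Option V) where
  toFun | .old v => some (some v) | .u => some none | .w => none
  invFun | some (some v) => .old v | some none => .u | none => .w
  left_inv n := by cases n <;> rfl
  right_inv n := by rcases n with _ | _ | n <;> rfl

theorem NodeZ.prod_univ [Fintype V] (f : NodeZ V → ℝ) : ∏ n, f n = f .z * ∏ v, f (.old v) := by
  rw [← NodeZ.equivOption.symm.prod_comp, Fintype.prod_option]
  rfl

theorem NodeWU.prod_univ [Fintype V] (f : NodeWU V → ℝ) :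
    ∏ n, f n = f .w * f .u * ∏ v, f (.old v) := by
  rw [← NodeWU.equivOption.symm.prod_comp, Fintype.prod_option, Fintype.prod_option, mul_assoc]
  rfl

theorem prob_mergeState [Fintype V] [DecidableEq V]
    (f : JointState (statesZ r p q) → ℝ)
    {E : JointState (statesZ r p q) → Prop} {E' : JointState (statesWU r p q) → Prop}
    (h : ∀ s, E' s ↔ E (mergeState s)) : prob (fun s => f (mergeState s)) E' = prob f E := by
  unfold prob
  refine Fintype.sum_equiv mergeEquiv _ _ fun s => ?_
  classical exact if_congr (h s) rfl rfl

theorem IsDistribution.split [Fintype V] [DecidableEq V]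
    {P : JointState (statesZ r p q) → ℝ} (h : IsDistribution P) :
    IsDistribution (splitData P) :=
  ⟨fun _ => h.1 _, by rw [← h.2]; exact Fintype.sum_equiv mergeEquiv _ _ fun _ => rfl⟩

/-- Replacing the deleted factor by 1 keeps the product over all nodes, so that `NodeZ.prod_univ`
and `NodeWU.prod_univ` apply. -/
theorem Finset.prod_univ_erase_eq_ite {N : Type*} [Fintype N] [DecidableEq N] (X : N)
    (f : N → ℝ) : ∏ n ∈ Finset.univ.erase X, f n = ∏ n, if n = X then 1 else f n := by
  rw [← Finset.prod_erase Finset.univ (a := X) (f := fun n => if n = X then 1 else f n) (by simp)]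
  exact Finset.prod_congr rfl fun n hn => by simp [Finset.ne_of_mem_erase hn]

/-! ### Matching causal models on the two graphs -/

variable {G : Digraph (NodeZ V)}

/-- The two models have the same conditional probabilities, where those of `w` and `u` are
multiplied. -/
def CausalModel.Matches (M : CausalModel G (statesZ r p q))
    (M' : CausalModel (splitGraph G) (statesWU r p q)) : Prop :=
  ∀ s : JointState (statesWU r p q),
    (∀ v, M'.cpt (.old v) (fun m => s m) (s (.old v)) =
      M.cpt (.old v) (fun m => mergeState s m) (mergeState s (.old v))) ∧
    M'.cpt .w (fun m => s m) (s .w) * M'.cpt .u (fun m => s m) (s .u) =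
      M.cpt .z (fun m => mergeState s m) (mergeState s .z)

theorem CausalModel.Matches.observational_eq [Fintype V]
    {M : CausalModel G (statesZ r p q)}
    {M' : CausalModel (splitGraph G) (statesWU r p q)} (h : M.Matches M') :
    M'.observational = splitData M.observational := by
  funext s
  unfold splitData CausalModel.observational
  rw [NodeZ.prod_univ, NodeWU.prod_univ, (h s).2]
  exact congrArg _ (Finset.prod_congr rfl fun v _ => (h s).1 v)

theorem CausalModel.Matches.effect_eq [Fintype V] [DecidableEq V]
    {M : CausalModel G (statesZ r p q)}
    {M' : CausalModel (splitGraph G) (statesWU r p q)} (h : M.Matches M') (X Y : V) :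
    M'.effect (.old X) (.old Y) = M.effect (.old X) (.old Y) := by
  funext x y
  have hi : M'.interventional (.old X) x =
      fun s => M.interventional (.old X) x (mergeState s) := by
    funext s
    unfold CausalModel.interventional
    rw [Finset.prod_univ_erase_eq_ite, Finset.prod_univ_erase_eq_ite, NodeZ.prod_univ,
      NodeWU.prod_univ]
    simp only [reduceCtorEq, if_false, NodeWU.old.injEq, NodeZ.old.injEq]
    rw [(h s).2]
    simp only [(h s).1]
    rfl
  unfold CausalModel.effect
  rw [hi]
  exact prob_mergeState _ fun s => Iff.rfl

/-- The state of the original parents of an old node. -/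
def mergeParents {v : V}
    (a : ∀ m : {m // (splitGraph G).Adj m (.old v)}, Fin (statesWU r p q m)) :
    ∀ m : {m // G.Adj m (.old v)}, Fin (statesZ r p q m)
  | ⟨.old n, h⟩ => a ⟨.old n, h⟩
  | ⟨.z, h⟩ => finProdFinEquiv ((a ⟨.w, h⟩ : Fin p), (a ⟨.u, h⟩ : Fin q))

/-- The state of the new parents of an old node. -/
def splitParents {v : V} (a : ∀ m : {m // G.Adj m (.old v)}, Fin (statesZ r p q m)) :
    ∀ m : {m // (splitGraph G).Adj m (.old v)}, Fin (statesWU r p q m)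
  | ⟨.old n, h⟩ => a ⟨.old n, h⟩
  | ⟨.w, h⟩ => (finProdFinEquiv.symm (a ⟨.z, h⟩ : Fin (p * q))).1
  | ⟨.u, h⟩ => (finProdFinEquiv.symm (a ⟨.z, h⟩ : Fin (p * q))).2

/-- The state of the parents of `z`, given that of the parents of `u`. -/
def parentsZOfU (hG : G.Acyclic)
    (a : ∀ m : {m // (splitGraph G).Adj m .u}, Fin (statesWU r p q m)) :
    ∀ m : {m // G.Adj m .z}, Fin (statesZ r p q m)
  | ⟨.old n, h⟩ => a ⟨.old n, h⟩
  | ⟨.z, h⟩ => absurd h (hG.not_adj_self _)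

/-- The state of the parents of `z`, given that of the parents of `w`. -/
def parentsZOfW (hG : G.Acyclic)
    (a : ∀ m : {m // (splitGraph G).Adj m .w}, Fin (statesWU r p q m)) :
    ∀ m : {m // G.Adj m .z}, Fin (statesZ r p q m)
  | ⟨.old n, h⟩ => a ⟨.old n, h⟩
  | ⟨.z, h⟩ => absurd h (hG.not_adj_self _)

/-- The state of the parents of `u`, given that of the parents of `z`. -/
def parentsU (a : ∀ m : {m // G.Adj m .z}, Fin (statesZ r p q m)) :
    ∀ m : {m // (splitGraph G).Adj m .u}, Fin (statesWU r p q m)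
  | ⟨.old n, h⟩ => a ⟨.old n, h⟩
  | ⟨.w, h⟩ => h.elim
  | ⟨.u, h⟩ => h.elim

/-- The state of the parents of `w`, given that of the parents of `z` and that of `u`. -/
def parentsW (a : ∀ m : {m // G.Adj m .z}, Fin (statesZ r p q m)) (k : Fin q) :
    ∀ m : {m // (splitGraph G).Adj m .w}, Fin (statesWU r p q m)
  | ⟨.old n, h⟩ => a ⟨.old n, h⟩
  | ⟨.w, h⟩ => h.elim
  | ⟨.u, _⟩ => k

theorem sum_sum_finProdFinEquiv (f : Fin (p * q) → ℝ) :
    ∑ k : Fin q, ∑ j : Fin p, f (finProdFinEquiv (j, k)) = ∑ i, f i := by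
  rw [← finProdFinEquiv.sum_comp, Fintype.sum_prod_type_right]

theorem sum_finProdFinEquiv_mul {f : Fin q → Fin p → ℝ} {g : Fin q → ℝ}
    (hf : ∀ k, ∑ j, f k j = 1) (hg : ∑ k, g k = 1) :
    ∑ i : Fin (p * q), f (finProdFinEquiv.symm i).2 (finProdFinEquiv.symm i).1 *
      g (finProdFinEquiv.symm i).2 = 1 := by
  rw [← sum_sum_finProdFinEquiv]
  simp only [Equiv.symm_apply_apply, ← Finset.sum_mul, hf, one_mul, hg]

/-- The model on the original graph that a model on the new graph stands for. -/
def CausalModel.merge (M : CausalModel (splitGraph G) (statesWU r p q)) :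
    CausalModel G (statesZ r p q) where
  cpt
    | .old v, a, i => M.cpt (.old v) (splitParents a) i
    | .z, a, i =>
      M.cpt .w (parentsW a (finProdFinEquiv.symm (i : Fin (p * q))).2)
          (finProdFinEquiv.symm (i : Fin (p * q))).1 *
        M.cpt .u (parentsU a) (finProdFinEquiv.symm (i : Fin (p * q))).2
  cpt_nonneg
    | .old _, _, _ => M.cpt_nonneg _ _ _
    | .z, _, _ => mul_nonneg (M.cpt_nonneg _ _ _) (M.cpt_nonneg _ _ _)
  cpt_sum
    | .old v, a => M.cpt_sum (.old v) (splitParents a)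
    | .z, a => sum_finProdFinEquiv_mul (fun k => M.cpt_sum .w (parentsW a k))
      (M.cpt_sum .u (parentsU a))

theorem CausalModel.merge_matches
    (M : CausalModel (splitGraph G) (statesWU r p q)) : M.merge.Matches M := by
  intro s
  refine ⟨fun v => ?_, ?_⟩
  · change _ = M.cpt (.old v) (splitParents _) _
    congr 1
    funext ⟨m, h⟩
    exact (congrFun (mergeEquiv.symm_apply_apply s) m).symm.trans (by cases m <;> rfl)
  · have hz : finProdFinEquiv.symm (mergeState s .z : Fin (p * q)) =
        ((s .w : Fin p), (s .u : Fin q)) := finProdFinEquiv.symm_apply_apply _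
    change _ = M.cpt .w (parentsW _ (finProdFinEquiv.symm (mergeState s .z : Fin (p * q))).2)
      (finProdFinEquiv.symm (mergeState s .z : Fin (p * q))).1 *
        M.cpt .u (parentsU _) (finProdFinEquiv.symm (mergeState s .z : Fin (p * q))).2
    rw [hz]
    congr 2
    · funext ⟨m, h⟩
      cases m with
      | old v => rfl
      | w => exact h.elim
      | u => rfl
    · funext ⟨m, h⟩
      cases m with
      | old v => rfl
      | w => exact h.elim
      | u => exact h.elim

/-- The marginal of the state of `u`, given the parents of `z`. -/
noncomputable def CausalModel.marginalU (M : CausalModel G (statesZ r p q))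
    (a : ∀ m : {m // G.Adj m .z}, Fin (statesZ r p q m)) (k : Fin q) : ℝ :=
  ∑ j : Fin p, M.cpt .z a (finProdFinEquiv (j, k))

theorem CausalModel.marginalU_nonneg (M : CausalModel G (statesZ r p q))
    (a : ∀ m : {m // G.Adj m .z}, Fin (statesZ r p q m)) (k : Fin q) : 0 ≤ M.marginalU a k :=
  Finset.sum_nonneg fun _ _ => M.cpt_nonneg _ _ _

/-- The conditional probability of the state of `w`, given the parents of `z` and the state
of `u`; it is uniform where the condition has probability zero. -/
noncomputable def CausalModel.conditionalW (M : CausalModel G (statesZ r p q))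
    (a : ∀ m : {m // G.Adj m .z}, Fin (statesZ r p q m)) (k : Fin q) (j : Fin p) : ℝ :=
  if M.marginalU a k = 0 then (p : ℝ)⁻¹ else M.cpt .z a (finProdFinEquiv (j, k)) / M.marginalU a k

theorem CausalModel.conditionalW_mul_marginalU (M : CausalModel G (statesZ r p q))
    (a : ∀ m : {m // G.Adj m .z}, Fin (statesZ r p q m)) (k : Fin q) (j : Fin p) :
    M.conditionalW a k j * M.marginalU a k = M.cpt .z a (finProdFinEquiv (j, k)) := by
  unfold CausalModel.conditionalW
  split_ifs with h
  -- A vanishing marginal is a sum of nonnegative terms, so each entry is 0 and the default value of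
  -- the quotient is irrelevant.
  · have := (Finset.sum_eq_zero_iff_of_nonneg (fun _ _ => M.cpt_nonneg _ _ _)).1 h j
      (Finset.mem_univ j)
    rw [h, mul_zero]
    exact this.symm
  · exact div_mul_cancel₀ _ h

/-- The model on the new graph that stands for a model on the original graph. -/
noncomputable def CausalModel.split (hG : G.Acyclic) (hp : p ≠ 0)
    (M : CausalModel G (statesZ r p q)) : CausalModel (splitGraph G) (statesWU r p q) where
  cpt
    | .old v, a, i => M.cpt (.old v) (mergeParents a) i
    | .w, a, j => M.conditionalW (parentsZOfW hG a) (a ⟨.u, trivial⟩) j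
    | .u, a, k => M.marginalU (parentsZOfU hG a) k
  cpt_nonneg
    | .old _, _, _ => M.cpt_nonneg _ _ _
    | .w, _, _ => by
      dsimp only
      unfold CausalModel.conditionalW
      split_ifs
      · positivity
      · exact div_nonneg (M.cpt_nonneg _ _ _) (M.marginalU_nonneg _ _)
    | .u, _, _ => M.marginalU_nonneg _ _
  cpt_sum
    | .old v, a => M.cpt_sum (.old v) (mergeParents a)
    | .w, a => by
      change ∑ j : Fin p, _ = _
      dsimp only
      unfold CausalModel.conditionalW
      split_ifs with h
      · simp [hp]
      · rw [← Finset.sum_div]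
        exact div_self h
    | .u, a => (sum_sum_finProdFinEquiv _).trans (M.cpt_sum .z (parentsZOfU hG a))

theorem CausalModel.matches_split (hG : G.Acyclic) (hp : p ≠ 0)
    (M : CausalModel G (statesZ r p q)) : M.Matches (M.split hG hp) := by
  intro s
  refine ⟨fun v => ?_, ?_⟩
  · change M.cpt (.old v) (mergeParents _) _ = _
    congr 1
    funext ⟨m, h⟩
    cases m <;> rfl
  · have hw : parentsZOfW hG (fun m => s m) =
        fun m : {m // G.Adj m .z} => mergeState s m := by
      funext ⟨m, h⟩
      cases m with
      | old v => rfl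
      | z => exact absurd h (hG.not_adj_self _)
    have hu : parentsZOfU hG (fun m => s m) =
        fun m : {m // G.Adj m .z} => mergeState s m := by
      funext ⟨m, h⟩
      cases m with
      | old v => rfl
      | z => exact absurd h (hG.not_adj_self _)
    change M.conditionalW (parentsZOfW hG _) (s .u) (s .w) *
      M.marginalU (parentsZOfU hG _) (s .u) = _
    rw [hw, hu]
    exact M.conditionalW_mul_marginalU _ _ _

/-- The uniform default law of `w` needs a state. Without one there are no joint states, and the
total mass would be 0. -/
theorem IsDistribution.ne_zero [Fintype V] [DecidableEq V]
    {P : JointState (statesZ r p q) → ℝ} (h : IsDistribution P) :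
    p ≠ 0 := by
  rintro rfl
  have : IsEmpty (JointState (statesZ r 0 q)) :=
    ⟨fun s => (finProdFinEquiv.symm (s .z : Fin (0 * q))).1.elim0⟩
  have h2 := h.2
  simp at h2

theorem causalEffects_splitGraph [Fintype V] [DecidableEq V] (hG : G.Acyclic) (hp : p ≠ 0)
    (P : JointState (statesZ r p q) → ℝ) (X Y : V) :
    causalEffects (splitGraph G) (splitData P) (.old X) (.old Y) =
      causalEffects G P (.old X) (.old Y) := by
  ext e
  constructor
  · rintro ⟨M, hM, rfl⟩
    refine ⟨M.merge, ?_, (M.merge_matches).effect_eq X Y⟩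
    have h := (M.merge_matches).observational_eq
    rw [hM] at h
    funext s
    -- Every original state is a merged one, so equality of the split data gives equality of the
    -- data.
    obtain ⟨s, rfl⟩ := mergeEquiv.surjective s
    exact (congrFun h s).symm
  · rintro ⟨M, rfl, rfl⟩
    exact ⟨M.split hG hp, (M.matches_split hG hp).observational_eq,
      ((M.matches_split hG hp).effect_eq X Y).symm⟩

/-! ### Invariance of the adjustment formulas -/

variable [Fintype V] [DecidableEq V]

/-- Joint states of `splitSet Q` are joint states of `Q`. -/
def mergeSetEquiv (Q : Finset (NodeZ V)) :
    (∀ n : splitSet Q, Fin (statesWU r p q n)) ≃ (∀ n : Q, Fin (statesZ r p q n)) where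
  toFun a
    | ⟨.old v, h⟩ => a ⟨.old v, mem_splitSet.2 h⟩
    | ⟨.z, h⟩ =>
      finProdFinEquiv ((a ⟨.w, mem_splitSet.2 h⟩ : Fin p), (a ⟨.u, mem_splitSet.2 h⟩ : Fin q))
  invFun a
    | ⟨.old v, h⟩ => a ⟨.old v, mem_splitSet.1 h⟩
    | ⟨.w, h⟩ => (finProdFinEquiv.symm (a ⟨.z, mem_splitSet.1 h⟩ : Fin (p * q))).1
    | ⟨.u, h⟩ => (finProdFinEquiv.symm (a ⟨.z, mem_splitSet.1 h⟩ : Fin (p * q))).2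
  left_inv a := by
    funext ⟨n, h⟩
    cases n with
    | old v => rfl
    | w => exact congrArg Prod.fst (finProdFinEquiv.symm_apply_apply ((_ : Fin p), (_ : Fin q)))
    | u => exact congrArg Prod.snd (finProdFinEquiv.symm_apply_apply ((_ : Fin p), (_ : Fin q)))
  right_inv a := by
    funext ⟨n, h⟩
    cases n with
    | old v => rfl
    | z => exact finProdFinEquiv.apply_symm_apply (_ : Fin (p * q))

theorem forall_splitSet_eq_iff {Q : Finset (NodeZ V)} (s : JointState (statesWU r p q))
    (a : ∀ n : splitSet Q, Fin (statesWU r p q n)) :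
    (∀ n : splitSet Q, s n = a n) ↔ ∀ n : Q, mergeState s n = mergeSetEquiv Q a n := by
  constructor
  · rintro h ⟨n, hn⟩
    cases n with
    | old v => exact h ⟨.old v, mem_splitSet.2 hn⟩
    | z =>
      exact (mergeState_z_eq_iff s _ _).2
        ⟨h ⟨.w, mem_splitSet.2 hn⟩, h ⟨.u, mem_splitSet.2 hn⟩⟩
  · rintro h ⟨n, hn⟩
    cases n with
    | old v => exact h ⟨.old v, mem_splitSet.1 hn⟩
    | w => exact ((mergeState_z_eq_iff s _ _).1 (h ⟨.z, mem_splitSet.1 hn⟩)).1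
    | u => exact ((mergeState_z_eq_iff s _ _).1 (h ⟨.z, mem_splitSet.1 hn⟩)).2

/-- The sums agree term by term, zero denominators included, so the criterion itself plays no role
here. -/
theorem backDoorFormula_splitData (P : JointState (statesZ r p q) → ℝ) (X Y : V)
    (Q : Finset (NodeZ V)) (x : Fin (r X)) (y : Fin (r Y)) :
    backDoorFormula (splitData P) (.old X) (.old Y) (splitSet Q) x y =
      backDoorFormula P (.old X) (.old Y) Q x y := by
  unfold backDoorFormula
  refine Fintype.sum_equiv (mergeSetEquiv Q) _ _ fun a => ?_
  congr 1
  · congr 1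
    · exact prob_mergeState P fun s => and_congr Iff.rfl (and_congr Iff.rfl
        (forall_splitSet_eq_iff s a))
    · exact prob_mergeState P fun s => and_congr Iff.rfl (forall_splitSet_eq_iff s a)
  · exact prob_mergeState P fun s => forall_splitSet_eq_iff s a

theorem frontDoorFormula_splitData (P : JointState (statesZ r p q) → ℝ) (X Y : V)
    (Q : Finset (NodeZ V)) (x : Fin (r X)) (y : Fin (r Y)) :
    frontDoorFormula (splitData P) (.old X) (.old Y) (splitSet Q) x y =
      frontDoorFormula P (.old X) (.old Y) Q x y := by
  unfold frontDoorFormula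
  refine Fintype.sum_equiv (mergeSetEquiv Q) _ _ fun a => ?_
  congr 1
  · congr 1
    · exact prob_mergeState P fun s => and_congr Iff.rfl (forall_splitSet_eq_iff s a)
    · exact prob_mergeState P fun s => Iff.rfl
  · refine Finset.sum_congr rfl fun x' _ => ?_
    congr 1
    · congr 1
      · exact prob_mergeState P fun s => and_congr Iff.rfl (and_congr Iff.rfl
          (forall_splitSet_eq_iff s a))
      · exact prob_mergeState P fun s => and_congr Iff.rfl (forall_splitSet_eq_iff s a)
    · exact prob_mergeState P fun s => Iff.rfl

end ModelLemmas

theorem theorem3 {V : Type*} [Fintype V] [DecidableEq V] (X Y : V) (hXY : X ≠ Y)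
    (r : V → ℕ) (p q : ℕ) (G : Digraph (NodeZ V)) (hG : G.Acyclic)
    (P : JointState (statesZ r p q) → ℝ) (hP : Compatible G P) :
    -- the new graph is a causal diagram, and the new data are compatible with it
    (splitGraph G).Acyclic ∧ Compatible (splitGraph G) (splitData P) ∧
    -- `P'(w_j, u_k, t) = P(z_{jq+k}, t)` for all states `t` of any set `S` of other nodes
    (∀ (S : Finset V) (t : ∀ v, Fin (r v)) (j : Fin p) (k : Fin q),
      prob (splitData P)
          (fun s => s .w = j ∧ s .u = k ∧ ∀ v ∈ S, s (.old v) = t v) =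
        prob P (fun s => s .z = finProdFinEquiv (j, k) ∧ ∀ v ∈ S, s (.old v) = t v)) ∧
    -- the back-door criterion carries over, and the adjustment formula has the same value
    (∀ Q : Finset (NodeZ V), G.BackDoor (.old X) (.old Y) Q →
      (splitGraph G).BackDoor (.old X) (.old Y) (splitSet Q) ∧
      ∀ (x : Fin (r X)) (y : Fin (r Y)),
        backDoorFormula (splitData P) (.old X) (.old Y) (splitSet Q) x y =
          backDoorFormula P (.old X) (.old Y) Q x y) ∧
    -- the front-door criterion carries over, and the adjustment formula has the same value
    (∀ Q : Finset (NodeZ V), G.FrontDoor (.old X) (.old Y) Q →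
      (splitGraph G).FrontDoor (.old X) (.old Y) (splitSet Q) ∧
      ∀ (x : Fin (r X)) (y : Fin (r Y)),
        frontDoorFormula (splitData P) (.old X) (.old Y) (splitSet Q) x y =
          frontDoorFormula P (.old X) (.old Y) Q x y) ∧
    -- the causal effects of `X` on `Y` are the same
    causalEffects (splitGraph G) (splitData P) (.old X) (.old Y) =
      causalEffects G P (.old X) (.old Y) := by
  obtain ⟨hD, M, hM⟩ := hP
  have hp := hD.ne_zero
  refine ⟨splitGraph_acyclic hG, ⟨hD.split, M.split hG hp, ?_⟩, fun S t j k => ?_,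
    fun Q hQ => ⟨hQ.split hG, backDoorFormula_splitData P X Y Q⟩,
    fun Q hQ => ⟨hQ.split hG, frontDoorFormula_splitData P X Y Q⟩,
    causalEffects_splitGraph hG hp P X Y⟩
  · rw [(M.matches_split hG hp).observational_eq, hM]
  · refine prob_mergeState P fun s => ?_
    rw [mergeState_z_eq_iff, and_assoc]
    rfl
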